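/- Let $k\ge 2$ be an integer and $\Sigma_k=\{0,1,\dots,k-1\}$. For $a_1\cdots a_t\in\Sigma_k^*$ put $[a_1\cdots a_t]_k=\sum_{i=1}^t a_ik^{t-i}$. For a word $w=[a_1,b_1]\cdots[a_t,b_t]$ over $\Sigma_k\times\Sigma_k$ put $\pi_1(w)=a_1\cdots a_t$ and $\pi_2(w)=b_1\cdots b_t$, and, if $[\pi_2(w)]_k\ne 0$, define $\mathrm{quo}_k(w)=[\pi_1(w)]_k/[\pi_2(w)]_k$. For a language $L\subseteq(\Sigma_k\times\Sigma_k)^*$ let $\mathrm{quo}_k(L)=\{\mathrm{quo}_k(w): w\in L,\ [\pi_2(w)]_k\neq 0\}$. (1) The following problem is recursively solvable: given an integer $k\ge 2$ and a DFA $M$ with input alphabet $\Sigma_k\times\Sigma_k$ (presented by its transition table), is $\mathrm{quo}_k(L(M))$ infinite? That is, a single algorithm answers this question correctly for all such $k$ and $M$. (2) Let $k\ge 2$ and let $M$ be a DFA with input alphabet $\Sigma_k\times\Sigma_k$ and $n$ states, and let $L=L(M)$. For words $u,v$ with $[\pi_2(uv)]_k\neq[\pi_2(u)]_k$ put $$\gamma_k(u,v)=\frac{[\pi_1(uv)]_k-[\pi_1(u)]_k}{[\pi_2(uv)]_k-[\pi_2(u)]_k},$$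 and let $T$ be the union of $\{\mathrm{quo}_k(x): x\in L,\ |x|<n,\ [\pi_2(x)]_k\ne 0\}$ and the set of all $\gamma_k(u,v)$ such that $uv$ is a prefix of a word of $L$, $|v|\ge 1$, $|uv|\le n$ and $[\pi_2(uv)]_k\neq[\pi_2(u)]_k$. Then $T$ is finite, and $\mathrm{quo}_k(L)$ is finite if and only if $\mathrm{quo}_k(L)\subseteq T$. -/

import Mathlib

namespace AutomaticRationals

/-- A word over the alphabet `Σ_k × Σ_k`, where `Σ_k = {0, …, k - 1}`. -/
abbrev PairWord (k : ℕ) : Type := List (Fin k × Fin k)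

/-- `[w]_k`: the number represented in base `k` by `w`, most significant digit first. -/
def value (k : ℕ) (w : List (Fin k)) : ℕ :=
  Nat.ofDigits k (w.reverse.map Fin.val)

/-- The numerator `[π₁(w)]_k`. -/
def num (k : ℕ) (w : PairWord k) : ℕ := value k (w.map Prod.fst)

/-- The denominator `[π₂(w)]_k`. -/
def den (k : ℕ) (w : PairWord k) : ℕ := value k (w.map Prod.snd)

/-- `quo_k(w)`; it is only used for words with `den k w ≠ 0`. -/
def quo (k : ℕ) (w : PairWord k) : ℚ := (num k w : ℚ) / (den k w : ℚ)

/-- `quo_k(L)`: the set of all `quo_k(w)` for the words `w ∈ L` at which `quo_k` is defined. -/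
def quoSet (k : ℕ) (L : Language (Fin k × Fin k)) : Set ℚ :=
  {r | ∃ w ∈ L, den k w ≠ 0 ∧ r = quo k w}

/-- `γ_k(u,v)`; it is only used for words with `den k (u ++ v) ≠ den k u`. -/
def gam (k : ℕ) (u v : PairWord k) : ℚ :=
  ((num k (u ++ v) : ℚ) - (num k u : ℚ)) / ((den k (u ++ v) : ℚ) - (den k u : ℚ))

/-- The language of all prefixes of words of `L`. -/
def pref {α : Type*} (L : Language α) : Language α :=
  {x | ∃ w ∈ L, x <+: w}

/-- The set `T` attached to a language `L` and a length bound `n`: the quotients of the words of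
`L` of length less than `n`, and all the `γ_k(u,v)` that are defined (nonzero denominator) with
`uv` a prefix of a word of `L`, `v` nonempty and `|uv| ≤ n`. -/
def testSet (k : ℕ) (L : Language (Fin k × Fin k)) (n : ℕ) : Set ℚ :=
  {r | ∃ x ∈ L, x.length < n ∧ den k x ≠ 0 ∧ r = quo k x} ∪
  {r | ∃ u v : PairWord k, u ++ v ∈ pref L ∧ 1 ≤ v.length ∧ (u ++ v).length ≤ n ∧
    den k (u ++ v) ≠ den k u ∧ r = gam k u v}

/-- Finite descriptions of automata over `Σ_k × Σ_k`: base, number of states, initial state,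
transition table, acceptance table. -/
abbrev DFACode : Type := ℕ × ℕ × ℕ × List (List (List ℕ)) × List Bool

open Classical in
/-- The description of the automaton `M` with states `0, …, n - 1`: the entry of the transition
table at position `q`, `a`, `b` is the state reached from `q` on the letter `[a,b]`, and the
entry of the acceptance table at position `q` says whether `q` is accepting. -/
noncomputable def encodeDFA {k n : ℕ} (M : DFA (Fin k × Fin k) (Fin n)) : DFACode :=
  (k, n, (M.start : ℕ),
    List.ofFn fun q : Fin n => List.ofFn fun a : Fin k => List.ofFn fun b : Fin k =>
      (M.step q (a, b) : ℕ),
    List.ofFn fun q : Fin n => decide (q ∈ M.accept))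

end AutomaticRationals

open AutomaticRationals

namespace AutomaticRationals

/-! ### Quotients along pumped words -/

section Values

variable {k : ℕ}

/-! For nonempty `v` and `K = k ^ |v|`, the numerator and denominator of `u v^i w` have the forms `A
K^i + B` and `A' K^i + B'`. Their quotient is a fractional linear function of `K^i`, hence constant
or injective in `i` according to whether `A B' - A' B` vanishes, and comparing `i = 0` with `i = 1`
tells which.

If a loop `v` of the automaton changes the quotient of an accepted word, pumping it yields
infinitely many quotients (`infinite_quo_of_distinguishes`). If no loop within the first `n` letters
does so, a word of length at least `n` either has quotient `γ(u,v)` or can lose its loop without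
changing its quotient; descent on length puts every quotient into the finite set `T`
(`quoSet_subset_testSet`). So infinitude is equivalent to the existence of a pump witness.

For decidability, `u` and `v` are already bounded, and `exists_short_pumpWitness` bounds `w`. The
remaining finite search is primitive recursive. -/

theorem value_append (x y : List (Fin k)) :
    value k (x ++ y) = value k x * k ^ y.length + value k y := by
  simp [value, Nat.ofDigits_append]; ring

theorem num_append (x y : PairWord k) :
    num k (x ++ y) = num k x * k ^ y.length + num k y := by
  simp [num, value_append]

theorem den_append (x y : PairWord k) :
    den k (x ++ y) = den k x * k ^ y.length + den k y := by
  simp [den, value_append]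

/-- The words `u w` and `u v w` represent different quotients. For `v ≠ []` this says that
`i ↦ quo k (u v ^ i w)` is injective, and otherwise this sequence is constant. -/
def Distinguishes (k : ℕ) (u v w : PairWord k) : Prop :=
  num k (u ++ w) * den k (u ++ v ++ w) ≠ num k (u ++ v ++ w) * den k (u ++ w)

/-- The `i`-fold repetition of a word. -/
def repeatWord (v : PairWord k) (i : ℕ) : PairWord k := (List.replicate i v).flatten

theorem append_repeatWord_succ (u v : PairWord k) (i : ℕ) :
    u ++ repeatWord v (i + 1) = u ++ repeatWord v i ++ v := by
  simp [repeatWord, List.replicate_succ']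

/-- Appending `v` acts by the affine map `s ↦ K s + f v`, whose fixed point is `-f v / (K - 1)`; the
distance to it grows geometrically. -/
theorem exists_geometric_form (f : PairWord k → ℕ)
    (hf : ∀ x y, f (x ++ y) = f x * k ^ y.length + f y) (hk : 2 ≤ k) (u v w : PairWord k)
    (hv : v ≠ []) : ∃ A B : ℚ, ∀ i : ℕ,
      (f (u ++ repeatWord v i ++ w) : ℚ) = A * ((k : ℚ) ^ v.length) ^ i + B := by
  have hK : ((k : ℚ) ^ v.length) - 1 ≠ 0 := by
    have h1 : 1 < (k : ℚ) := by exact_mod_cast hk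
    have := one_lt_pow₀ h1 (n := v.length) (by simpa using hv)
    linarith
  generalize hKd : (k : ℚ) ^ v.length = K at hK
  have key : ∀ i : ℕ, (f (u ++ repeatWord v i) : ℚ)
      = (f u + f v / (K - 1)) * K ^ i - f v / (K - 1) := by
    intro i
    induction i with
    | zero => simp [repeatWord]
    | succ i ih =>
      rw [append_repeatWord_succ, hf]
      push_cast
      rw [ih, hKd]
      field_simp
      ring
  refine ⟨(f u + f v / (K - 1)) * k ^ w.length, f w - f v / (K - 1) * k ^ w.length, fun i => ?_⟩
  rw [hf]
  push_cast
  rw [key]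
  ring

/-- A distinguishing triple yields infinitely many quotients. -/
theorem infinite_quo_of_distinguishes (hk : 2 ≤ k) {u v w : PairWord k}
    (h : Distinguishes k u v w) (S : Set ℚ)
    (hS : ∀ i, den k (u ++ repeatWord v i ++ w) ≠ 0 → quo k (u ++ repeatWord v i ++ w) ∈ S) :
    S.Infinite := by
  have hv : v ≠ [] := by
    rintro rfl
    simp [Distinguishes] at h
  obtain ⟨A, B, hA⟩ := exists_geometric_form (num k) num_append hk u v w hv
  obtain ⟨A', B', hA'⟩ := exists_geometric_form (den k) den_append hk u v w hv
  have hinj : Function.Injective fun i : ℕ => ((k : ℚ) ^ v.length) ^ i := by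
    have h1 : 1 < (k : ℚ) := by exact_mod_cast hk
    exact (pow_right_strictMono₀ (one_lt_pow₀ h1 (n := v.length) (by simpa using hv))).injective
  generalize (k : ℚ) ^ v.length = K at *
  -- The cross difference between `i = 0` and `i = 1` is `(1 - K) (A B' - A' B)`.
  have hne : A * B' ≠ A' * B := by
    intro he
    apply h
    have h0 := hA 0
    have h1 := hA 1
    have h0' := hA' 0
    have h1' := hA' 1
    simp only [repeatWord, List.replicate_zero, List.replicate_one, List.flatten_nil,
      List.flatten_singleton, List.append_nil] at h0 h1 h0' h1'
    have : (num k (u ++ w) : ℚ) * den k (u ++ v ++ w)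
        = num k (u ++ v ++ w) * den k (u ++ w) := by
      rw [h0, h1, h0', h1']
      linear_combination (1 - K) * he
    exact_mod_cast this
  have hcross : ∀ i j : ℕ,
      (num k (u ++ repeatWord v i ++ w) : ℚ) * den k (u ++ repeatWord v j ++ w)
        = num k (u ++ repeatWord v j ++ w) * den k (u ++ repeatWord v i ++ w) → i = j := by
    intro i j hij
    rw [hA, hA, hA', hA'] at hij
    have h2 : (A * B' - A' * B) * (K ^ i - K ^ j) = 0 := by linear_combination hij
    rcases mul_eq_zero.1 h2 with h3 | h3
    · exact absurd (sub_eq_zero.1 h3) hne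
    · exact hinj (sub_eq_zero.1 h3)
  have hinf : {i : ℕ | den k (u ++ repeatWord v i ++ w) ≠ 0}.Infinite := by
    -- Two vanishing denominators would make the cross products agree trivially, so at most one
    -- exponent is lost.
    have hsub : {i : ℕ | den k (u ++ repeatWord v i ++ w) = 0}.Subsingleton := by
      intro i hi j hj
      apply hcross
      have hi' : den k (u ++ repeatWord v i ++ w) = 0 := hi
      have hj' : den k (u ++ repeatWord v j ++ w) = 0 := hj
      rw [hi', hj']
      simp
    exact hsub.finite.infinite_compl
  refine (hinf.image (f := fun i => quo k (u ++ repeatWord v i ++ w)) ?_).mono ?_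
  · intro i hi j hj hij
    apply hcross
    have hi' : (den k (u ++ repeatWord v i ++ w) : ℚ) ≠ 0 := by exact_mod_cast hi
    have hj' : (den k (u ++ repeatWord v j ++ w) : ℚ) ≠ 0 := by exact_mod_cast hj
    simp only [quo] at hij
    rwa [div_eq_div_iff hi' hj'] at hij
  · rintro _ ⟨i, hi, rfl⟩
    exact hS i hi

/-- If `u v w` is not distinguishing, its quotient is either `γ_k(u,v)` or the quotient of `u w`. -/
theorem quo_eq_gam_or_quo_of_not_distinguishes (hk : 2 ≤ k) {u v w : PairWord k}
    (h : ¬ Distinguishes k u v w) (hd : den k (u ++ v ++ w) ≠ 0) :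
    (den k (u ++ v) ≠ den k u ∧ quo k (u ++ v ++ w) = gam k u v) ∨
      (den k (u ++ w) ≠ 0 ∧ quo k (u ++ v ++ w) = quo k (u ++ w)) := by
  rw [Distinguishes, not_not] at h
  have hd' : (den k (u ++ v ++ w) : ℚ) ≠ 0 := by exact_mod_cast hd
  by_cases hg : den k (u ++ v) = den k u
  · right
    have e : den k (u ++ v ++ w) = den k (u ++ w) := by rw [den_append _ w, hg, ← den_append]
    rw [e] at h hd
    refine ⟨hd, ?_⟩
    rw [quo, quo, e, Nat.eq_of_mul_eq_mul_right (Nat.pos_of_ne_zero hd) h]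
  · left
    refine ⟨hg, ?_⟩
    have hg' : (den k (u ++ v) : ℚ) - den k u ≠ 0 := by
      rw [sub_ne_zero]; exact_mod_cast hg
    have hkw : ((k : ℚ) ^ w.length) ≠ 0 := by
      have : (k : ℚ) ≠ 0 := by exact_mod_cast (by omega : k ≠ 0)
      positivity
    rw [quo, gam, div_eq_div_iff hd' hg']
    have h2 : (num k (u ++ w) : ℚ) * den k (u ++ v ++ w)
        = num k (u ++ v ++ w) * den k (u ++ w) := by exact_mod_cast h
    rw [num_append u w, num_append _ w, den_append u w, den_append _ w] at h2
    rw [num_append _ w, den_append _ w]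
    push_cast at h2 ⊢
    -- Passing from `u w` to `u v w` changes numerator and denominator by `k ^ |w|` times those of
    -- `γ(u,v)`; equal fractions share the quotient of their differences.
    apply mul_right_cancel₀ hkw
    linear_combination h2

end Values

/-! ### Loops of automata and short witnesses -/

section Automata

variable {k : ℕ} {σ : Type*}

/-- A loop of the automaton `M` read within its first `n` letters and a continuation to an
accepted word along which the loop changes the quotient. -/
def IsPumpWitness (M : DFA (Fin k × Fin k) σ) (n : ℕ) (u v w : PairWord k) : Prop :=
  u.length + v.length ≤ n ∧ M.eval (u ++ v) = M.eval u ∧ u ++ v ++ w ∈ M.accepts ∧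
    Distinguishes k u v w

theorem eval_append_repeatWord (M : DFA (Fin k × Fin k) σ) {u v : PairWord k}
    (h : M.eval (u ++ v) = M.eval u) (i : ℕ) : M.eval (u ++ repeatWord v i) = M.eval u := by
  induction i with
  | zero => simp [repeatWord]
  | succ i ih =>
    rw [append_repeatWord_succ]
    rw [DFA.eval, DFA.evalFrom_of_append] at h ⊢
    rw [DFA.eval] at ih
    rw [ih, h]

theorem IsPumpWitness.infinite (hk : 2 ≤ k) {M : DFA (Fin k × Fin k) σ} {n : ℕ}
    {u v w : PairWord k} (h : IsPumpWitness M n u v w) : (quoSet k M.accepts).Infinite := by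
  obtain ⟨-, hloop, hacc, hdist⟩ := h
  refine infinite_quo_of_distinguishes hk hdist _ fun i hi => ⟨_, ?_, hi, rfl⟩
  rw [DFA.mem_accepts, DFA.eval, DFA.evalFrom_of_append] at hacc ⊢
  have := eval_append_repeatWord M hloop i
  rw [DFA.eval] at this hloop
  rw [this]
  rw [hloop] at hacc
  exact hacc

/-- Descent on word length: a long accepted word has a loop in its first `n` letters, which gives a
`γ` value or can be cut out. -/
theorem quoSet_subset_testSet [Fintype σ] (hk : 2 ≤ k) (M : DFA (Fin k × Fin k) σ)
    (h : ∀ u v w, ¬ IsPumpWitness M (Fintype.card σ) u v w) :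
    quoSet k M.accepts ⊆ testSet k M.accepts (Fintype.card σ) := by
  rintro _ ⟨x, hx, hd, rfl⟩
  induction hl : x.length using Nat.strong_induction_on generalizing x with
  | _ l ih =>
  subst hl
  rcases lt_or_ge x.length (Fintype.card σ) with hlt | hge
  · exact Or.inl ⟨x, hx, hlt, hd, rfl⟩
  obtain ⟨q, u, v, w, rfl, hlen, hv, hu, hq, hw⟩ := M.evalFrom_split hge rfl
  have hloop : M.evalFrom M.start (u ++ v) = M.evalFrom M.start u := by
    rw [DFA.evalFrom_of_append, hu, hq]
  have hvl : 0 < v.length := List.length_pos_iff.2 hv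
  have hnd : ¬ Distinguishes k u v w := fun hdist => h u v w ⟨hlen, hloop, hx, hdist⟩
  rcases quo_eq_gam_or_quo_of_not_distinguishes hk hnd hd with ⟨hg, he⟩ | ⟨hd', he⟩
  · exact Or.inr ⟨u, v, ⟨_, hx, List.prefix_append _ _⟩, hvl, by simpa using hlen, hg, he⟩
  · rw [he]
    refine ih _ ?_ (u ++ w) ?_ hd' rfl
    · simp only [List.length_append]; omega
    · rw [DFA.mem_accepts, DFA.eval, DFA.evalFrom_of_append, hu, hw]
      exact hx

theorem finite_testSet (L : Language (Fin k × Fin k)) (n : ℕ) : (testSet k L n).Finite := by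
  have hfin : {x : PairWord k | x.length ≤ n}.Finite := List.finite_length_le _ _
  refine Set.Finite.union ((hfin.image (quo k)).subset ?_)
    (((hfin.prod hfin).image fun p => gam k p.1 p.2).subset ?_)
  · rintro _ ⟨x, -, hx, -, rfl⟩
    exact ⟨x, hx.le, rfl⟩
  · rintro _ ⟨u, v, -, -, hl, -, rfl⟩
    rw [List.length_append] at hl
    exact ⟨(u, v), ⟨by simp; omega, by simp; omega⟩, rfl⟩

theorem infinite_quoSet_iff [Fintype σ] (hk : 2 ≤ k) (M : DFA (Fin k × Fin k) σ) :
    (quoSet k M.accepts).Infinite ↔ ∃ u v w, IsPumpWitness M (Fintype.card σ) u v w := by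
  refine ⟨fun h => ?_, fun ⟨u, v, w, h⟩ => h.infinite hk⟩
  by_contra! hne
  exact h ((finite_testSet _ _).subset (quoSet_subset_testSet hk M hne))

theorem finite_quoSet_iff [Fintype σ] (hk : 2 ≤ k) (M : DFA (Fin k × Fin k) σ) :
    (quoSet k M.accepts).Finite ↔
      quoSet k M.accepts ⊆ testSet k M.accepts (Fintype.card σ) := by
  refine ⟨fun h => quoSet_subset_testSet hk M fun u v w hw => hw.infinite hk h,
    fun h => (finite_testSet _ _).subset h⟩

/-- Let `ℓ` be an integer-valued function of words whose value after reading a further word `z`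
is an injective function of its value before. If `ℓ` does not vanish on all words leading from
`s` to `F`, then it does not vanish at such a word of length less than twice the number of
states. -/
theorem exists_short_of_ne_zero {α : Type*} [Fintype σ] (M : DFA α σ) (s : σ) (F : Set σ)
    (ℓ : List α → ℤ)
    (hext : ∀ x y z, ℓ (x ++ z) = ℓ (y ++ z) ↔ ℓ x = ℓ y)
    {w : List α} (hw : M.evalFrom s w ∈ F) (hℓ : ℓ w ≠ 0) :
    ∃ w, w.length < 2 * Fintype.card σ ∧ M.evalFrom s w ∈ F ∧ ℓ w ≠ 0 := by
  induction hl : w.length using Nat.strong_induction_on generalizing w with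
  | _ l ih =>
  subst hl
  rcases lt_or_ge w.length (2 * Fintype.card σ) with hlt | hge
  · exact ⟨w, hlt, hw, hℓ⟩
  obtain ⟨q, a, b, c, rfl, hlen, hb, ha, hq, hc⟩ :=
    M.evalFrom_split (s := s) (by omega : Fintype.card σ ≤ w.length) rfl
  simp only [List.length_append] at hge
  -- The first loop ends within `n` letters, so at least `n` letters remain for a second, disjoint
  -- loop.
  obtain ⟨q', a', b', c', rfl, hlen', hb', ha', hq', hc'⟩ :=
    M.evalFrom_split (s := q) (by omega : Fintype.card σ ≤ c.length) rfl
  have hbl : 0 < b.length := List.length_pos_iff.2 hb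
  have hbl' : 0 < b'.length := List.length_pos_iff.2 hb'
  rw [← hc, ← hc'] at hw
  by_contra hno
  have hzero : ∀ y : List α, y.length < (a ++ b ++ (a' ++ b' ++ c')).length →
      M.evalFrom s y ∈ F → ℓ y = 0 := by
    intro y hy hyF
    by_contra hy0
    exact hno (ih _ hy hyF hy0 rfl)
  -- By minimality `ℓ` vanishes after deleting either loop or both. Cancelling the common suffix `a'
  -- c'` gives `ℓ (a b) = ℓ a`, and appending `a' b' c'` carries the zero in `e₁` back to the full
  -- word.
  have e₁ := hzero (a ++ (a' ++ b' ++ c')) (by simp; omega)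
    (by simpa [DFA.evalFrom_of_append, ha, ha', hq'] using hw)
  have e₂ := hzero (a ++ (a' ++ c')) (by simp; omega)
    (by simpa [DFA.evalFrom_of_append, ha, ha'] using hw)
  have e₃ := hzero (a ++ b ++ (a' ++ c')) (by simp; omega)
    (by simpa [DFA.evalFrom_of_append, ha, hq, ha'] using hw)
  have e₄ : ℓ (a ++ b) = ℓ a := (hext _ _ _).1 (e₃.trans e₂.symm)
  exact hℓ (((hext _ _ _).2 e₄).trans e₁)

theorem exists_short_pumpWitness [Fintype σ] (hk : 2 ≤ k) {M : DFA (Fin k × Fin k) σ} {n : ℕ}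
    {u v w : PairWord k} (h : IsPumpWitness M n u v w) :
    ∃ w, w.length < 2 * Fintype.card σ ∧ IsPumpWitness M n u v w := by
  obtain ⟨hlen, hloop, hacc, hdist⟩ := h
  -- In the cross difference the term `num w * den w` cancels, so a factor `k ^ |w|` splits off; `ℓ`
  -- is the cofactor.
  set ℓ : PairWord k → ℤ := fun w =>
    ((num k u : ℤ) * den k (u ++ v) - num k (u ++ v) * den k u) * k ^ w.length
      + (den k (u ++ v) - den k u) * num k w - (num k (u ++ v) - num k u) * den k w with hℓdef
  have hk0 : (k : ℤ) ≠ 0 := by exact_mod_cast (by omega : k ≠ 0)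
  have hℓ : ∀ w, Distinguishes k u v w ↔ ℓ w ≠ 0 := by
    intro w
    rw [Distinguishes, ← (Nat.cast_injective (R := ℤ)).ne_iff, ← sub_ne_zero]
    have : ((num k (u ++ w) * den k (u ++ v ++ w) : ℕ) : ℤ)
        - (num k (u ++ v ++ w) * den k (u ++ w) : ℕ) = k ^ w.length * ℓ w := by
      rw [num_append u w, num_append _ w, den_append u w, den_append _ w, hℓdef]
      push_cast
      ring
    rw [this, mul_ne_zero_iff, and_iff_right (pow_ne_zero _ hk0)]
  have hext : ∀ x y z, ℓ (x ++ z) = ℓ (y ++ z) ↔ ℓ x = ℓ y := by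
    intro x y z
    have hz : ((k : ℤ) ^ z.length) ≠ 0 := pow_ne_zero _ hk0
    have hsub : ℓ (x ++ z) - ℓ (y ++ z) = (ℓ x - ℓ y) * k ^ z.length := by
      simp only [hℓdef, num_append _ z, den_append _ z, List.length_append, pow_add]
      push_cast
      ring
    rw [← sub_eq_zero, hsub, mul_eq_zero, or_iff_left hz, sub_eq_zero]
  have hmem : ∀ w, u ++ v ++ w ∈ M.accepts ↔ M.evalFrom (M.eval u) w ∈ M.accept := by
    intro w
    rw [DFA.mem_accepts, DFA.eval, DFA.evalFrom_of_append, ← DFA.eval, hloop]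
  obtain ⟨w', h₁, h₂, h₃⟩ := exists_short_of_ne_zero M (M.eval u) M.accept ℓ hext
    ((hmem w).1 hacc) ((hℓ w).1 hdist)
  exact ⟨w', h₁, hlen, hloop, (hmem w').2 h₂, (hℓ w').2 h₃⟩

end Automata

/-! ### The bounded search on automaton codes -/

section Search

/-- The state reached from `q` on the letter `p`, read off the transition table. -/
def codeStep (c : DFACode) (q : ℕ) (p : ℕ × ℕ) : ℕ :=
  ((c.2.2.2.1.getD q []).getD p.1 []).getD p.2 0

/-- The state reached from the initial state on the word `w`. -/
def codeEval (c : DFACode) (w : List (ℕ × ℕ)) : ℕ := w.foldl (codeStep c) c.2.2.1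

/-- Whether the described automaton accepts the word `w`. -/
def codeAccepts (c : DFACode) (w : List (ℕ × ℕ)) : Bool := c.2.2.2.2.getD (codeEval c w) false

/-- The number with base `k` digits `w`, most significant digit first. -/
def hornerValue (k : ℕ) (w : List ℕ) : ℕ := w.foldl (fun s d => s * k + d) 0

/-- All letters `[a,b]` with `a, b < k`. -/
def letters (k : ℕ) : List (ℕ × ℕ) :=
  (List.range k).flatMap fun a => (List.range k).map fun b => (a, b)

/-- All words of length at most `n` with digits less than `k`. -/
def wordsUpTo (k n : ℕ) : List (List (ℕ × ℕ)) :=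
  (fun l => [] :: l.flatMap fun w => (letters k).map fun p => p :: w)^[n] [[]]

/-- The numerator of a word of pairs of digits. -/
def codeNum (k : ℕ) (w : List (ℕ × ℕ)) : ℕ := hornerValue k (w.map Prod.fst)

/-- The denominator of a word of pairs of digits. -/
def codeDen (k : ℕ) (w : List (ℕ × ℕ)) : ℕ := hornerValue k (w.map Prod.snd)

/-- Whether `v` is a loop after `u` that changes the quotient of the accepted word `u v w`. -/
def codeIsWitness (c : DFACode) (u v w : List (ℕ × ℕ)) : Bool :=
  decide (codeEval c (u ++ v) = codeEval c u) && (codeAccepts c (u ++ v ++ w) &&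
    !decide (codeNum c.1 (u ++ w) * codeDen c.1 (u ++ v ++ w)
      = codeNum c.1 (u ++ v ++ w) * codeDen c.1 (u ++ w)))

/-- The search for a distinguishing triple of words of length at most twice the number of
states. -/
def searchWitness (c : DFACode) : Bool :=
  (wordsUpTo c.1 (2 * c.2.1)).any fun u => (wordsUpTo c.1 (2 * c.2.1)).any fun v =>
    (wordsUpTo c.1 (2 * c.2.1)).any fun w => codeIsWitness c u v w

theorem mem_letters {k : ℕ} {p : ℕ × ℕ} : p ∈ letters k ↔ p.1 < k ∧ p.2 < k := by
  obtain ⟨a, b⟩ := p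
  simp [letters]

theorem mem_wordsUpTo {k n : ℕ} {w : List (ℕ × ℕ)} :
    w ∈ wordsUpTo k n ↔ w.length ≤ n ∧ ∀ p ∈ w, p ∈ letters k := by
  induction n generalizing w with
  | zero =>
    simp only [wordsUpTo, Function.iterate_zero, id, List.mem_singleton, Nat.le_zero,
      List.length_eq_zero_iff]
    refine ⟨?_, And.left⟩
    rintro rfl
    simp
  | succ n ih =>
    rw [wordsUpTo, Function.iterate_succ_apply', ← wordsUpTo]
    cases w with
    | nil => simp
    | cons p w =>
      obtain ⟨a, b⟩ := p
      simp [ih]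
      tauto

/-! ### Primitive recursiveness of the search -/

section Primitive

open Primrec

variable {α β : Type*} [Primcodable α] [Primcodable β]

theorem primrec_list_any {f : α → List β} {g : α → β → Bool} (hf : Primrec f)
    (hg : Primrec₂ g) : Primrec fun a => (f a).any (g a) :=
  (list_foldr hf (Primrec.const false) (h := fun a p => g a p.1 || p.2)
    (Primrec.or.comp (hg.comp fst (fst.comp snd)) (snd.comp snd)).to₂).of_eq fun a => by
      induction f a <;> simp [*]

theorem primrec_codeStep : Primrec fun x : DFACode × ℕ × ℕ × ℕ => codeStep x.1 x.2.1 x.2.2 :=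
  (list_getD 0).comp
    ((list_getD []).comp
      ((list_getD []).comp (fst.comp (snd.comp (snd.comp (snd.comp fst)))) (fst.comp snd))
      (fst.comp (snd.comp snd)))
    (snd.comp (snd.comp snd))

theorem primrec_codeEval : Primrec₂ codeEval :=
  list_foldl (f := fun x : DFACode × List (ℕ × ℕ) => x.2) (g := fun x => x.1.2.2.1)
    (h := fun x p => codeStep x.1 p.1 p.2) snd (fst.comp (snd.comp (snd.comp fst)))
    (primrec_codeStep.comp (pair (fst.comp fst) snd)).to₂

theorem primrec_codeAccepts : Primrec₂ codeAccepts :=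
  (list_getD false).comp (snd.comp (snd.comp (snd.comp (snd.comp fst)))) primrec_codeEval

theorem primrec_hornerValue : Primrec₂ hornerValue :=
  list_foldl (f := fun x : ℕ × List ℕ => x.2) (g := fun _ => 0)
    (h := fun x p => p.1 * x.1 + p.2) snd (Primrec.const 0)
    (nat_add.comp (nat_mul.comp (fst.comp snd) (fst.comp fst)) (snd.comp snd)).to₂

theorem primrec_codeNum : Primrec₂ codeNum :=
  primrec_hornerValue.comp fst (list_map snd (fst.comp snd).to₂)

theorem primrec_codeDen : Primrec₂ codeDen :=
  primrec_hornerValue.comp fst (list_map snd (snd.comp snd).to₂)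

theorem primrec_letters : Primrec letters :=
  list_flatMap list_range
    (list_map (list_range.comp fst) (pair (snd.comp fst) snd).to₂).to₂

theorem primrec_wordsUpTo : Primrec₂ wordsUpTo :=
  nat_iterate (f := fun x : ℕ × ℕ => x.2) (g := fun _ => [[]])
    (h := fun x l => [] :: l.flatMap fun w => (letters x.1).map fun p => p :: w)
    snd (Primrec.const [[]])
    (list_cons.comp (Primrec.const [])
      (list_flatMap snd
        (list_map (primrec_letters.comp (fst.comp (fst.comp fst)))
          (list_cons.comp snd (snd.comp fst)).to₂).to₂)).to₂

theorem primrec_codeIsWitness {f : α → DFACode} {u v w : α → List (ℕ × ℕ)} (hf : Primrec f)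
    (hu : Primrec u) (hv : Primrec v) (hw : Primrec w) :
    Primrec fun a => codeIsWitness (f a) (u a) (v a) (w a) := by
  have huv : Primrec fun a => u a ++ v a := list_append.comp hu hv
  have huw : Primrec fun a => u a ++ w a := list_append.comp hu hw
  have huvw : Primrec fun a => u a ++ v a ++ w a := list_append.comp huv hw
  have hk : Primrec fun a => (f a).1 := fst.comp hf
  exact Primrec.and.comp
    (Primrec.eq.decide.comp (primrec_codeEval.comp hf huv) (primrec_codeEval.comp hf hu))
    (Primrec.and.comp (primrec_codeAccepts.comp hf huvw)
      (Primrec.not.comp (Primrec.eq.decide.comp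
        (nat_mul.comp (primrec_codeNum.comp hk huw) (primrec_codeDen.comp hk huvw))
        (nat_mul.comp (primrec_codeNum.comp hk huvw) (primrec_codeDen.comp hk huw)))))

theorem primrec_searchWitness : Primrec searchWitness := by
  have hwords : Primrec fun c : DFACode => wordsUpTo c.1 (2 * c.2.1) :=
    primrec_wordsUpTo.comp fst (nat_mul.comp (Primrec.const 2) (fst.comp snd))
  have hwit : Primrec fun x : ((DFACode × List (ℕ × ℕ)) × List (ℕ × ℕ)) × List (ℕ × ℕ) =>
      codeIsWitness x.1.1.1 x.1.1.2 x.1.2 x.2 :=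
    primrec_codeIsWitness (fst.comp (fst.comp fst)) (snd.comp (fst.comp fst)) (snd.comp fst) snd
  have hthird : Primrec fun x : (DFACode × List (ℕ × ℕ)) × List (ℕ × ℕ) =>
      (wordsUpTo x.1.1.1 (2 * x.1.1.2.1)).any (codeIsWitness x.1.1 x.1.2 x.2) :=
    primrec_list_any (hwords.comp (fst.comp fst)) hwit.to₂
  have hsecond : Primrec fun x : DFACode × List (ℕ × ℕ) =>
      (wordsUpTo x.1.1 (2 * x.1.2.1)).any fun v =>
        (wordsUpTo x.1.1 (2 * x.1.2.1)).any (codeIsWitness x.1 x.2 v) :=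
    primrec_list_any (hwords.comp fst) hthird.to₂
  exact primrec_list_any hwords hsecond.to₂

end Primitive

/-! ### Correctness of the search on encoded automata -/

section Correctness

variable {k n : ℕ}

/-- A word over `Σ_k × Σ_k` as a word of pairs of natural numbers. -/
def toNatWord (w : PairWord k) : List (ℕ × ℕ) := w.map fun p => ((p.1 : ℕ), (p.2 : ℕ))

theorem toNatWord_append (x y : PairWord k) :
    toNatWord (x ++ y) = toNatWord x ++ toNatWord y := by simp [toNatWord]

theorem hornerValue_map_val (w : List (Fin k)) : hornerValue k (w.map Fin.val) = value k w := by
  induction w using List.reverseRecOn with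
  | nil => simp [hornerValue, value]
  | append_singleton w a ih =>
    rw [value_append, ← ih]
    simp [hornerValue, value]

theorem codeNum_toNatWord (w : PairWord k) : codeNum k (toNatWord w) = num k w := by
  rw [num, ← hornerValue_map_val]
  simp [codeNum, toNatWord, Function.comp_def]

theorem codeDen_toNatWord (w : PairWord k) : codeDen k (toNatWord w) = den k w := by
  rw [den, ← hornerValue_map_val]
  simp [codeDen, toNatWord, Function.comp_def]

theorem getD_ofFn {α : Type*} {m : ℕ} (f : Fin m → α) (i : Fin m) (d : α) :
    (List.ofFn f).getD i d = f i := by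
  simp [List.getD_eq_getElem?_getD]

/-- On a genuine encoding every lookup is in range, so the default values in `codeStep` play no
role. -/
theorem codeStep_encodeDFA (M : DFA (Fin k × Fin k) (Fin n)) (q : Fin n) (p : Fin k × Fin k) :
    codeStep (encodeDFA M) q ((p.1 : ℕ), (p.2 : ℕ)) = M.step q p := by
  simp only [codeStep, encodeDFA]
  rw [getD_ofFn, getD_ofFn, getD_ofFn]

theorem codeEval_encodeDFA (M : DFA (Fin k × Fin k) (Fin n)) (w : PairWord k) :
    codeEval (encodeDFA M) (toNatWord w) = M.eval w := by
  induction w using List.reverseRecOn with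
  | nil => rfl
  | append_singleton w p ih =>
    rw [DFA.eval_append_singleton, ← codeStep_encodeDFA, ← ih]
    simp [codeEval, toNatWord]

theorem codeAccepts_encodeDFA (M : DFA (Fin k × Fin k) (Fin n)) (w : PairWord k) :
    codeAccepts (encodeDFA M) (toNatWord w) = true ↔ w ∈ M.accepts := by
  rw [codeAccepts, codeEval_encodeDFA, DFA.mem_accepts, encodeDFA, getD_ofFn]
  exact @decide_eq_true_iff _ (Classical.propDecidable _)

/-- The bound `|u| + |v|` makes the length condition vacuous; lengths are controlled by the word
lists instead. -/
theorem codeIsWitness_encodeDFA (M : DFA (Fin k × Fin k) (Fin n)) (u v w : PairWord k) :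
    codeIsWitness (encodeDFA M) (toNatWord u) (toNatWord v) (toNatWord w) = true ↔
      IsPumpWitness M (u.length + v.length) u v w := by
  have hk : (encodeDFA M).1 = k := rfl
  simp only [codeIsWitness, ← toNatWord_append, codeEval_encodeDFA, hk, codeNum_toNatWord,
    codeDen_toNatWord, Bool.and_eq_true, codeAccepts_encodeDFA, IsPumpWitness, Distinguishes,
    decide_eq_true_eq, Bool.not_eq_true', decide_eq_false_iff_not, le_refl, true_and,
    Fin.val_inj, ne_eq]

theorem mem_wordsUpTo_iff_exists {m : ℕ} {x : List (ℕ × ℕ)} :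
    x ∈ wordsUpTo k m ↔ ∃ w : PairWord k, w.length ≤ m ∧ toNatWord w = x := by
  rw [mem_wordsUpTo]
  constructor
  · rintro ⟨hl, hx⟩
    refine ⟨x.pmap (fun p hp => (⟨p.1, (mem_letters.1 hp).1⟩, ⟨p.2, (mem_letters.1 hp).2⟩)) hx,
      by simpa using hl, ?_⟩
    simp [toNatWord, List.map_pmap]
  · rintro ⟨w, hl, rfl⟩
    refine ⟨by simpa [toNatWord] using hl, fun p hp => ?_⟩
    obtain ⟨q, -, rfl⟩ := List.mem_map.1 hp
    exact mem_letters.2 ⟨q.1.2, q.2.2⟩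

theorem searchWitness_encodeDFA (hk : 2 ≤ k) (M : DFA (Fin k × Fin k) (Fin n)) :
    searchWitness (encodeDFA M) = true ↔ (quoSet k M.accepts).Infinite := by
  have hc : (encodeDFA M).1 = k ∧ (encodeDFA M).2.1 = n := ⟨rfl, rfl⟩
  simp only [searchWitness, hc, List.any_eq_true, mem_wordsUpTo_iff_exists]
  constructor
  · rintro ⟨_, ⟨u, -, rfl⟩, _, ⟨v, -, rfl⟩, _, ⟨w, -, rfl⟩, h⟩
    exact ((codeIsWitness_encodeDFA M u v w).1 h).infinite hk
  · intro h
    obtain ⟨u, v, w₀, h₀⟩ := (infinite_quoSet_iff hk M).1 h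
    obtain ⟨w, hw, hlen, hwit⟩ := exists_short_pumpWitness hk h₀
    rw [Fintype.card_fin] at hlen hw
    -- Here `|u| + |v| ≤ n` and `|w| < 2n`, so the single bound `2n` serves all three words.
    exact ⟨_, ⟨u, by omega, rfl⟩, _, ⟨v, by omega, rfl⟩, _, ⟨w, hw.le, rfl⟩,
      (codeIsWitness_encodeDFA M u v w).2 ⟨le_rfl, hwit⟩⟩

end Correctness

end Search

end AutomaticRationals

open AutomaticRationals
theorem mainTheorem3 :
    (∃ decideInfinite : DFACode → Bool, Computable decideInfinite ∧
      ∀ (k : ℕ), 2 ≤ k → ∀ (n : ℕ) (M : DFA (Fin k × Fin k) (Fin n)),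
        decideInfinite (encodeDFA M) = true ↔ (quoSet k M.accepts).Infinite) ∧
    (∀ (k : ℕ), 2 ≤ k → ∀ (σ : Type*) [Fintype σ] (M : DFA (Fin k × Fin k) σ),
      (testSet k M.accepts (Fintype.card σ)).Finite ∧
      ((quoSet k M.accepts).Finite ↔
        quoSet k M.accepts ⊆ testSet k M.accepts (Fintype.card σ))) :=
  ⟨⟨searchWitness, primrec_searchWitness.to_comp, fun _ hk _ M => searchWitness_encodeDFA hk M⟩,
    fun _ hk _ _ M => ⟨finite_testSet _ _, finite_quoSet_iff hk M⟩⟩
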